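/- Let $(X,d)$ be a Gromov-hyperbolic metric space that is Busemann regular: $X$ is proper and uniquely geodesic, and for all $x,y\in X$ the function $z\mapsto \beta_z(x,y)=d(x,z)-d(y,z)$ extends continuously from $X$ to $X\cup\partial X$; write $\beta_\xi(x,y)$ for its value at $\xi\in\partial X$. Let $\Gamma$ be a discrete group of isometries of $X$ (that is, acting properly discontinuously on $X$), and let $\Lambda_\Gamma\subseteq\partial X$ be its limit set. Let $P$ be the set of parabolic points, i.e. of the $p\in\Lambda_\Gamma$ whose stabilizer in $\Gamma$ is infinite and contains no loxodromic element; assume that $P\neq\emptyset$. Assume that $\Gamma$ acts geometrically finitely: every point of $\Lambda_\Gamma$ is either a conical limit point or a bounded parabolic point (a parabolic point $p$ whose stabilizer acts cocompactly on $\Lambda_\Gamma\smallsetminus\{p\}$). Fix a base point $o\in X$. For $p\in\partial X$ and $\rho>0$ let $H_p(\rho)=\{x\in X : \beta_p(o,x)\ge -\log\rho\}$ be the horoball centered at $p$ of radius $\rho$, and let $\mathcal H_p(\rho)\subseteq\partial X$ be its shadow, the set of endpoints of the geodesic rays from $o$ that meet $H_p(\rho)$. Fix a $\Gamma$-invariant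 horoball packing, i.e. radii $r_p>0$ $(p\in P)$ such that the open horoballs $\{x\in X : \beta_p(o,x)>-\log r_p\}$, $p\in P$, are pairwise disjoint and $\Gamma$ maps the one centered at $p$ onto the one centered at $\gamma p$ for every $\gamma\in\Gamma$. For $s>0$ put $P_s=\{p\in P : r_p\ge s\}$. Then there are constants $c_1,c_2,c_3>0$ such that for all $0<s\le c_1$ $$\Lambda_\Gamma\subseteq\bigcup_{p\in P_s}\mathcal H_p\big(c_2\sqrt{s\,r_p}\big),$$ and the shadows $\mathcal H_p\big(c_3\sqrt{s\,r_p}\big)$, $p\in P_s$, are pairwise disjoint. -/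

import Mathlib

open Filter Topology Set
open scoped NNReal

/-! ### Gromov hyperbolic spaces, their boundary, and the bordification -/

/-- The Gromov product of `x` and `y` with respect to `o`. -/
noncomputable def gromovProduct {X : Type*} [MetricSpace X] (o x y : X) : ℝ :=
  (dist x o + dist y o - dist x y) / 2

/-- Gromov hyperbolicity, by the four point inequality. -/
def IsGromovHyperbolic (X : Type*) [MetricSpace X] : Prop :=
  ∃ α : ℝ, 0 < α ∧ ∀ o x y z : X,
    min (gromovProduct o x z) (gromovProduct o z y) - α ≤ gromovProduct o x y

/-- Any two points are joined by exactly one geodesic segment. -/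
def IsUniquelyGeodesic (X : Type*) [MetricSpace X] : Prop :=
  ∀ x y : X, ∃! f : Set.Icc (0 : ℝ) (dist x y) → X,
    Isometry f ∧ f ⟨0, le_rfl, dist_nonneg⟩ = x ∧ f ⟨dist x y, dist_nonneg, le_rfl⟩ = y

/-- A geodesic ray, parametrized by arc length. -/
structure GeodesicRay (X : Type*) [MetricSpace X] where
  toFun : ℝ≥0 → X
  isometry_toFun : Isometry toFun

instance {X : Type*} [MetricSpace X] : CoeFun (GeodesicRay X) (fun _ => ℝ≥0 → X) :=
  ⟨GeodesicRay.toFun⟩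

/-- Two rays are asymptotic if they stay within bounded distance of each other. -/
instance GeodesicRay.asymptotic (X : Type*) [MetricSpace X] : Setoid (GeodesicRay X) where
  r a b := ∃ C : ℝ, ∀ t, dist (a t) (b t) ≤ C
  iseqv :=
    { refl := fun a => ⟨0, fun t => by simp⟩
      symm := fun ⟨C, h⟩ => ⟨C, fun t => by rw [dist_comm]; exact h t⟩
      trans := fun ⟨C, h⟩ ⟨D, k⟩ =>
        ⟨C + D, fun t => (dist_triangle _ _ _).trans (add_le_add (h t) (k t))⟩ }

/-- The hyperbolic boundary `∂X`: asymptoty classes of geodesic rays. -/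
def Boundary (X : Type*) [MetricSpace X] : Type _ :=
  Quotient (GeodesicRay.asymptotic X)

/-- The point at infinity of a ray. -/
def GeodesicRay.endpoint {X : Type*} [MetricSpace X] (a : GeodesicRay X) : Boundary X :=
  Quotient.mk (GeodesicRay.asymptotic X) a

/-- The space `X ∪ ∂X`. -/
inductive Bordification (X : Type*) [MetricSpace X] where
  | interior (x : X) : Bordification X
  | ideal (ξ : Boundary X) : Bordification X

/-- A path that represents a point of `X ∪ ∂X`: a constant path for a point of `X`, a geodesic
ray with the given endpoint for a point of `∂X`. -/
def Bordification.IsRepresentedBy {X : Type*} [MetricSpace X] :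
    Bordification X → (ℝ≥0 → X) → Prop
  | .interior x, f => ∀ t, f t = x
  | .ideal ξ, f => ∃ a : GeodesicRay X, a.endpoint = ξ ∧ ∀ t, f t = a t

/-- The points of `X ∪ ∂X` whose Gromov product with `ξ`, seen from `o`, is larger than `R`
(for a boundary point the Gromov product is taken as a limit along representing paths). -/
def boundaryBall {X : Type*} [MetricSpace X] (o : X) (ξ : Boundary X) (R : ℝ) :
    Set (Bordification X) :=
  {b | ∀ f g : ℝ≥0 → X, (Bordification.ideal ξ).IsRepresentedBy f → b.IsRepresentedBy g →
    ∀ᶠ p : ℝ≥0 × ℝ≥0 in atTop, R < gromovProduct o (f p.1) (g p.2)}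

/-- The usual topology of `X ∪ ∂X`: `X` is an open subspace, and the sets `boundaryBall o ξ R`
shrink to the boundary point `ξ` as `R` tends to infinity. -/
instance Bordification.topology (X : Type*) [MetricSpace X] :
    TopologicalSpace (Bordification X) where
  IsOpen U := IsOpen (Bordification.interior ⁻¹' U) ∧
    ∀ ξ : Boundary X, Bordification.ideal ξ ∈ U → ∀ o : X, ∃ R : ℝ, boundaryBall o ξ R ⊆ U
  isOpen_univ := ⟨by simp, fun _ _ _ => ⟨0, subset_univ _⟩⟩
  isOpen_inter := by
    rintro U V ⟨hU, hU'⟩ ⟨hV, hV'⟩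
    refine ⟨hU.inter hV, fun ξ hξ o => ?_⟩
    obtain ⟨R, hR⟩ := hU' ξ hξ.1 o
    obtain ⟨S, hS⟩ := hV' ξ hξ.2 o
    refine ⟨max R S, fun b hb => ⟨hR fun f g hf hg => ?_, hS fun f g hf hg => ?_⟩⟩
    · exact (hb f g hf hg).mono fun p hp => (le_max_left R S).trans_lt hp
    · exact (hb f g hf hg).mono fun p hp => (le_max_right R S).trans_lt hp
  isOpen_sUnion := by
    intro 𝒰 h𝒰
    refine ⟨?_, ?_⟩
    · rw [preimage_sUnion]
      exact isOpen_biUnion fun U hU => (h𝒰 U hU).1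
    · rintro ξ ⟨U, hU, hξ⟩ o
      obtain ⟨R, hR⟩ := (h𝒰 U hU).2 ξ hξ o
      exact ⟨R, hR.trans (subset_sUnion_of_mem hU)⟩

/-- The topology of `∂X` as a subspace of `X ∪ ∂X`. -/
instance Boundary.topology (X : Type*) [MetricSpace X] : TopologicalSpace (Boundary X) :=
  TopologicalSpace.induced Bordification.ideal (Bordification.topology X)

/-! ### Busemann functions, horoballs and shadows -/

/-- `X` is Busemann regular: it is proper and uniquely geodesic, and the Busemann functions
`z ↦ β_z(x, y) = d(x, z) - d(y, z)` extend continuously to `X ∪ ∂X`. -/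
structure IsBusemannRegular (X : Type*) [MetricSpace X] : Prop where
  proper : ProperSpace X
  uniquelyGeodesic : IsUniquelyGeodesic X
  extends_continuously : ∀ x y : X, ∃ F : Bordification X → ℝ,
    Continuous F ∧ ∀ z : X, F (Bordification.interior z) = dist x z - dist y z

/-- The Busemann function `β_ξ(x, y)`, the limit of `d(x, z) - d(y, z)` as `z ∈ X` tends to `ξ`. -/
noncomputable def busemann {X : Type*} [MetricSpace X] (ξ : Boundary X) (x y : X) : ℝ :=
  haveI : Nonempty ℝ := ⟨0⟩
  limUnder (comap (Bordification.interior (X := X)) (𝓝 (Bordification.ideal ξ)))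
    (fun z => dist x z - dist y z)

/-- The closed horoball `H_p(ρ)` centered at `p` of radius `ρ > 0`, seen from `o`. Its signed
distance from `o` is `-log ρ`. -/
noncomputable def horoball {X : Type*} [MetricSpace X] (o : X) (p : Boundary X) (ρ : ℝ) :
    Set X :=
  {x | -Real.log ρ ≤ busemann p o x}

/-- The open horoball centered at `p` of radius `ρ > 0`, seen from `o`. -/
noncomputable def openHoroball {X : Type*} [MetricSpace X] (o : X) (p : Boundary X) (ρ : ℝ) :
    Set X :=
  {x | -Real.log ρ < busemann p o x}

/-- The shadow of a set `S` seen from `o`: the endpoints of the rays from `o` that meet `S`. -/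
def shadow {X : Type*} [MetricSpace X] (o : X) (S : Set X) : Set (Boundary X) :=
  {ξ | ∃ a : GeodesicRay X, a 0 = o ∧ a.endpoint = ξ ∧ ∃ t, a t ∈ S}

/-! ### Isometric actions, limit points, geometrical finiteness -/

section Action

variable (Γ X : Type*) [MetricSpace X] [Group Γ] [MulAction Γ X] [IsIsometricSMul Γ X]

/-- The action on the boundary that is induced by an isometric action on `X`. -/
instance Boundary.mulAction : MulAction Γ (Boundary X) where
  smul g := Quotient.map
    (fun a : GeodesicRay X =>
      (⟨fun t => g • a t, (isometry_smul X g).comp a.isometry_toFun⟩ : GeodesicRay X))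
    (by rintro a b ⟨C, h⟩; exact ⟨C, fun t => by simpa using h t⟩)
  one_smul := by
    rintro ⟨a⟩
    refine Quotient.sound ⟨0, fun t => ?_⟩
    simp
  mul_smul := by
    rintro g h ⟨a⟩
    refine Quotient.sound ⟨0, fun t => ?_⟩
    simp [mul_smul]

/-- The limit set `Λ_Γ`: the accumulation points in `∂X` of the orbits of `Γ` in `X`. -/
def limitSet : Set (Boundary X) :=
  {ξ | ∀ x : X, Bordification.ideal ξ ∈
    closure (Bordification.interior '' (MulAction.orbit Γ x))}

variable {Γ} in
/-- `g` acts as a loxodromic isometry: its orbits are quasi-isometrically embedded. -/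
def IsLoxodromic (g : Γ) : Prop :=
  ∃ x : X, ∃ c : ℝ, 0 < c ∧ ∀ n : ℕ, c * n ≤ dist x (g ^ n • x)

/-- A limit point is parabolic if its stabilizer is a parabolic group: infinite and without
loxodromic elements. -/
def parabolicPoints : Set (Boundary X) :=
  {ξ | ξ ∈ limitSet Γ X ∧ (MulAction.stabilizer Γ ξ : Set Γ).Infinite ∧
    ∀ g ∈ MulAction.stabilizer Γ ξ, ¬ IsLoxodromic X g}

variable {X}

/-- A parabolic point `ξ` is bounded if its stabilizer acts cocompactly on `Λ_Γ ∖ {ξ}`. -/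
def IsBoundedParabolic (ξ : Boundary X) : Prop :=
  ξ ∈ parabolicPoints Γ X ∧ ∃ K : Set (Boundary X), IsCompact K ∧ K ⊆ limitSet Γ X \ {ξ} ∧
    ∀ η ∈ limitSet Γ X \ {ξ}, ∃ g ∈ MulAction.stabilizer Γ ξ, ∃ κ ∈ K, g • κ = η

/-- `ξ` is a conical limit point: it is the limit of a sequence of orbit points `γₙ o` that stays
within bounded distance of a ray from `o` to `ξ`. -/
def IsConicalLimitPoint (ξ : Boundary X) : Prop :=
  ∃ (o : X) (a : GeodesicRay X) (γ : ℕ → Γ) (D : ℝ), a 0 = o ∧ a.endpoint = ξ ∧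
    Tendsto (fun n => Bordification.interior (γ n • o)) atTop (𝓝 (Bordification.ideal ξ)) ∧
    ∀ n, ∃ t, dist (γ n • o) (a t) ≤ D

variable (X) in
/-- Every limit point is conical or bounded parabolic. -/
def IsGeometricallyFinite : Prop :=
  ∀ ξ ∈ limitSet Γ X, IsConicalLimitPoint Γ ξ ∨ IsBoundedParabolic Γ ξ

/-- The radii `r p`, for `p` a parabolic point, define a `Γ`-invariant horoball packing: the open
horoballs centered at `p` of radius `r p` are pairwise disjoint, and `Γ` permutes them. -/
structure IsHoroballPacking (o : X) (r : Boundary X → ℝ) : Prop where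
  pos : ∀ p ∈ parabolicPoints Γ X, 0 < r p
  disjoint : (parabolicPoints Γ X).PairwiseDisjoint fun p => openHoroball o p (r p)
  invariant : ∀ g : Γ, ∀ p ∈ parabolicPoints Γ X,
    (fun x => g • x) '' openHoroball o p (r p) = openHoroball o (g • p) (r (g • p))

/-- The set `P_s` of the parabolic points `p` with `r_p ≥ s`. -/
def largeParabolicPoints (r : Boundary X → ℝ) (s : ℝ) : Set (Boundary X) :=
  {p ∈ parabolicPoints Γ X | s ≤ r p}

end Action

/-! The heart is `exists_forall_ray_depth`: rays from `o` to limit points stay within a bounded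
distance `D` of the horoballs of the packing. Along such a ray the Busemann function of a point `p`
is, up to `2α`, a tent of slopes `1` and `-1` (`min_le_busemann_ray`), so one value on the ray
controls how deep the ray enters the horoballs at `p`, and conversely.

Covering: at time about `-log s` the ray is almost in the horoball of some `p`. Since `β_p` grows at
most at unit speed from `o`, this forces `r_p ≥ s`, and the tent peaks at about `-(log s + log
r_p)/2`, which is the radius `√(s r_p)`. Disjointness: a ray meeting a small enough multiple of that
horoball is inside the packing horoball of `p` at time about `-log s`. For two points `p`, `q` with
a common shadow point, the two rays from `o` are `4α`-close at that time, so the packing horoballs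
would meet.

If the heart failed, there would be points `y_n` on such rays arbitrarily far from all horoballs.
Translate them by `Γ` so that `o` is their nearest orbit point; they still lie in front of limit
points as seen from `o` (`exists_forall_ray_idealProduct`), hence accumulate at a limit point. If
that point is conical, orbit points along a ray to it are nearer to `y_n` than `o`. If it is bounded
parabolic, cocompactness of its stabilizer provides a nearer one
(`IsBoundedParabolic.exists_dist_lt`).

Gromov products of two boundary points are never formed: a bound on them is expressed by bounding
`min (idealProduct o ξ x) (idealProduct o η x)` over all `x` in `X`. -/

/-- The four point inequality with constant `α`. -/
def HyperbolicWith (X : Type*) [MetricSpace X] (α : ℝ) : Prop :=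
  ∀ o x y z : X, min (gromovProduct o x z) (gromovProduct o z y) - α ≤ gromovProduct o x y

/-! ### Gromov products and convergence of rays. -/

section Basic

variable {X : Type*} [MetricSpace X] {α : ℝ}

lemma gromovProduct_comm (o x y : X) : gromovProduct o x y = gromovProduct o y x := by
  unfold gromovProduct; rw [dist_comm x y]; ring

lemma gromovProduct_le_left (o x y : X) : gromovProduct o x y ≤ dist x o := by
  unfold gromovProduct
  have := dist_triangle_left y o x
  linarith

lemma gromovProduct_le_right (o x y : X) : gromovProduct o x y ≤ dist y o := by
  rw [gromovProduct_comm]; exact gromovProduct_le_left o y x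

lemma HyperbolicWith.le_of_le (hα : HyperbolicWith X α) {o x y z : X} {R : ℝ}
    (h₁ : R ≤ gromovProduct o x z) (h₂ : R ≤ gromovProduct o z y) :
    R - α ≤ gromovProduct o x y :=
  (sub_le_sub_right (le_min h₁ h₂) α).trans (hα o x y z)

lemma HyperbolicWith.nonneg (hα : HyperbolicWith X α) (o : X) : 0 ≤ α := by
  have := hα o o o o
  simp only [gromovProduct, dist_self, min_self] at this
  linarith

lemma GeodesicRay.dist_eq (a : GeodesicRay X) (s t : ℝ≥0) :
    dist (a s) (a t) = |(s : ℝ) - t| := by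
  rw [a.isometry_toFun.dist_eq, NNReal.dist_eq]

lemma GeodesicRay.dist_eq_of_le (a : GeodesicRay X) {s t : ℝ≥0} (h : s ≤ t) :
    dist (a s) (a t) = t - s := by
  rw [a.dist_eq, abs_sub_comm, abs_of_nonneg (by simpa using h)]

lemma GeodesicRay.dist_zero (a : GeodesicRay X) (t : ℝ≥0) : dist (a 0) (a t) = t := by
  rw [a.dist_eq_of_le zero_le]; simp

lemma GeodesicRay.endpoint_eq_iff {a b : GeodesicRay X} :
    a.endpoint = b.endpoint ↔ ∃ C : ℝ, ∀ t, dist (a t) (b t) ≤ C :=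
  Quotient.eq

lemma Boundary.exists_ray (ξ : Boundary X) : ∃ a : GeodesicRay X, a.endpoint = ξ :=
  Quotient.exists_rep ξ

/-- Two points of a ray have large Gromov product. -/
lemma GeodesicRay.le_gromovProduct (a : GeodesicRay X) (o : X) {s t : ℝ≥0} (h : t ≤ s) :
    (t : ℝ) - dist o (a 0) ≤ gromovProduct o (a s) (a t) := by
  unfold gromovProduct
  have h1 := a.dist_eq_of_le h
  have h2 := a.dist_zero s
  have h3 := a.dist_zero t
  have h4 := dist_triangle (a 0) o (a s)
  have h5 := dist_triangle (a 0) o (a t)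
  rw [dist_comm (a s) (a t), h1, dist_comm (a s) o, dist_comm (a t) o]
  rw [dist_comm (a 0) o] at h4 h5
  linarith

/-- The Gromov product with a fixed point of a ray is eventually bounded below along every
asymptotic ray, uniformly. -/
lemma HyperbolicWith.eventually_le_gromovProduct (hα : HyperbolicWith X α) (o : X)
    {a f : GeodesicRay X} (h : f.endpoint = a.endpoint) (t : ℝ≥0) :
    ∀ᶠ s in atTop, (t : ℝ) - dist o (a 0) - α ≤ gromovProduct o (f s) (a t) := by
  obtain ⟨C, hC⟩ := GeodesicRay.endpoint_eq_iff.1 h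
  have hC0 : 0 ≤ C := dist_nonneg.trans (hC 0)
  filter_upwards [eventually_ge_atTop (t + ⟨C, hC0⟩)] with s hs
  have hs' : (t : ℝ) + C ≤ s := by exact_mod_cast hs
  refine hα.le_of_le (z := a s) ?_ (a.le_gromovProduct o (le_self_add.trans hs))
  unfold gromovProduct
  have h1 := hC s
  have h2 := a.dist_zero s
  have h3 := dist_triangle (a 0) o (a s)
  have h4 := dist_triangle_left (a s) o (f s)
  rw [dist_comm (a 0) o] at h3
  rw [dist_comm (a s) o] at *
  linarith

lemma GeodesicRay.tendsto_interior (hα : HyperbolicWith X α) (a : GeodesicRay X) :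
    Tendsto (fun t => Bordification.interior (a t)) atTop
      (𝓝 (Bordification.ideal a.endpoint)) := by
  refine tendsto_nhds.2 fun U hU hξ => ?_
  obtain ⟨R, hR⟩ := hU.2 _ hξ (a 0)
  obtain ⟨T, hT⟩ := exists_nat_gt (R + α)
  filter_upwards [eventually_ge_atTop (T : ℝ≥0)] with t ht
  refine hR fun f g hf hg => ?_
  obtain ⟨f', hf', hff'⟩ := hf
  rw [← prod_atTop_atTop_eq]
  have h1 := hα.eventually_le_gromovProduct (a 0) hf' t
  refine (h1.prod_inl _).mono fun p hp => ?_
  have hg' : g p.2 = a t := hg p.2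
  rw [hg', hff']
  have ht' : (T : ℝ) ≤ t := by exact_mod_cast ht
  rw [dist_self] at hp
  linarith

end Basic

/-! ### Busemann functions and Gromov products with a boundary point. -/

section Busemann

variable {X : Type*} [MetricSpace X] {α : ℝ}

/-- The Gromov product of a boundary point and a point. -/
noncomputable def idealProduct (o : X) (ξ : Boundary X) (x : X) : ℝ :=
  (dist o x + busemann ξ o x) / 2

/-- Rays converge to their endpoints, so the filter in `limUnder` is proper and `busemann` is a
genuine limit rather than a junk value. -/
lemma IsBusemannRegular.exists_extension (hα : HyperbolicWith X α) (reg : IsBusemannRegular X)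
    (x y : X) : ∃ F : Bordification X → ℝ, Continuous F ∧
      (∀ z, F (Bordification.interior z) = dist x z - dist y z) ∧
      ∀ ξ, F (Bordification.ideal ξ) = busemann ξ x y := by
  obtain ⟨F, hF, hF'⟩ := reg.extends_continuously x y
  refine ⟨F, hF, hF', fun ξ => ?_⟩
  obtain ⟨a, rfl⟩ := ξ.exists_ray
  have : (comap (Bordification.interior (X := X))
      (𝓝 (Bordification.ideal a.endpoint))).NeBot := by
    have h := tendsto_comap_iff.2 (a.tendsto_interior hα)
    exact h.neBot
  refine (Tendsto.limUnder_eq ?_).symm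
  have h := hF.continuousAt.tendsto.comp
    (tendsto_comap (f := Bordification.interior (X := X))
      (x := 𝓝 (Bordification.ideal a.endpoint)))
  exact h.congr hF'

lemma tendsto_busemann (hα : HyperbolicWith X α) (reg : IsBusemannRegular X) {a : GeodesicRay X}
    {ξ : Boundary X} (ha : a.endpoint = ξ) (x y : X) :
    Tendsto (fun t => dist x (a t) - dist y (a t)) atTop (𝓝 (busemann ξ x y)) := by
  obtain ⟨F, hF, hF', hF''⟩ := reg.exists_extension hα x y
  subst ha
  rw [← hF'']
  exact ((hF.continuousAt.tendsto).comp (a.tendsto_interior hα)).congr fun t => hF' _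

lemma continuous_busemann (hα : HyperbolicWith X α) (reg : IsBusemannRegular X) (x y : X) :
    Continuous fun ξ : Boundary X => busemann ξ x y := by
  obtain ⟨F, hF, hF', hF''⟩ := reg.exists_extension hα x y
  simp_rw [← hF'']
  exact hF.comp continuous_induced_dom

lemma busemann_add (hα : HyperbolicWith X α) (reg : IsBusemannRegular X) (ξ : Boundary X)
    (x y z : X) : busemann ξ x y + busemann ξ y z = busemann ξ x z := by
  obtain ⟨a, ha⟩ := ξ.exists_ray
  refine tendsto_nhds_unique
    (((tendsto_busemann hα reg ha x y).add (tendsto_busemann hα reg ha y z)).congr fun t => ?_)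
    (tendsto_busemann hα reg ha x z)
  ring

lemma busemann_le_dist (hα : HyperbolicWith X α) (reg : IsBusemannRegular X) (ξ : Boundary X)
    (x y : X) : busemann ξ x y ≤ dist x y := by
  obtain ⟨a, ha⟩ := ξ.exists_ray
  refine le_of_tendsto (tendsto_busemann hα reg ha x y) (Eventually.of_forall fun t => ?_)
  have := dist_triangle x y (a t)
  linarith

lemma busemann_self (hα : HyperbolicWith X α) (reg : IsBusemannRegular X) (ξ : Boundary X)
    (x : X) : busemann ξ x x = 0 := by
  have := busemann_add hα reg ξ x x x
  linarith

lemma busemann_comm (hα : HyperbolicWith X α) (reg : IsBusemannRegular X) (ξ : Boundary X)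
    (x y : X) : busemann ξ y x = -busemann ξ x y := by
  have := busemann_add hα reg ξ x y x
  rw [busemann_self hα reg] at this
  linarith

lemma neg_dist_le_busemann (hα : HyperbolicWith X α) (reg : IsBusemannRegular X)
    (ξ : Boundary X) (x y : X) : -dist x y ≤ busemann ξ x y := by
  have := busemann_le_dist hα reg ξ y x
  rw [busemann_comm hα reg, dist_comm] at this
  linarith

lemma busemann_ray (hα : HyperbolicWith X α) (reg : IsBusemannRegular X) {ξ : Boundary X}
    {a : GeodesicRay X} (ha : a.endpoint = ξ) {s t : ℝ≥0} (h : s ≤ t) :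
    busemann ξ (a s) (a t) = t - s := by
  refine tendsto_nhds_unique (tendsto_busemann hα reg ha (a s) (a t))
    (tendsto_const_nhds.congr' ?_)
  filter_upwards [eventually_ge_atTop t] with u hu
  rw [a.dist_eq_of_le hu, a.dist_eq_of_le (h.trans hu)]
  ring

/-- Because this is a true limit, the four point inequality passes to one boundary point with the
same constant `α`. -/
lemma tendsto_idealProduct (hα : HyperbolicWith X α) (reg : IsBusemannRegular X)
    {a : GeodesicRay X} {ξ : Boundary X} (ha : a.endpoint = ξ) (o x : X) :
    Tendsto (fun t => gromovProduct o (a t) x) atTop (𝓝 (idealProduct o ξ x)) := by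
  refine (((tendsto_busemann hα reg ha o x).const_add (dist o x)).div_const 2).congr fun t => ?_
  unfold gromovProduct
  rw [dist_comm (a t) o, dist_comm x o, dist_comm (a t) x]
  ring

lemma idealProduct_ray (hα : HyperbolicWith X α) (reg : IsBusemannRegular X) {ξ : Boundary X}
    {a : GeodesicRay X} (ha : a.endpoint = ξ) {s t : ℝ≥0} (h : s ≤ t) :
    idealProduct (a s) ξ (a t) = t - s := by
  rw [idealProduct, busemann_ray hα reg ha h, a.dist_eq_of_le h]; ring

/-- Exchanges viewpoints: `ξ` is behind `y` as seen from `x` exactly when its product with `x` is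
small as seen from `y`. -/
lemma idealProduct_add (hα : HyperbolicWith X α) (reg : IsBusemannRegular X) (ξ : Boundary X)
    (x y : X) : idealProduct x ξ y + idealProduct y ξ x = dist x y := by
  rw [idealProduct, idealProduct, busemann_comm hα reg ξ x y, dist_comm y x]; ring

lemma min_idealProduct_le_gromovProduct (hα : HyperbolicWith X α) (reg : IsBusemannRegular X)
    (o : X) (ξ : Boundary X) (x y : X) :
    min (idealProduct o ξ x) (idealProduct o ξ y) - α ≤ gromovProduct o x y := by
  obtain ⟨a, ha⟩ := ξ.exists_ray
  refine le_of_tendsto (((tendsto_idealProduct hα reg ha o x).min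
    (tendsto_idealProduct hα reg ha o y)).sub_const α) (Eventually.of_forall fun t => ?_)
  have := hα o x y (a t)
  rwa [gromovProduct_comm o x] at this

lemma min_gromovProduct_le_idealProduct (hα : HyperbolicWith X α) (reg : IsBusemannRegular X)
    (o : X) (ξ : Boundary X) (x y : X) :
    min (idealProduct o ξ y) (gromovProduct o y x) - α ≤ idealProduct o ξ x := by
  obtain ⟨a, ha⟩ := ξ.exists_ray
  exact le_of_tendsto_of_tendsto' (((tendsto_idealProduct hα reg ha o y).min
    tendsto_const_nhds).sub_const α) (tendsto_idealProduct hα reg ha o x)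
    fun t => hα o (a t) x y

lemma le_gromovProduct_of_le_idealProduct (hα : HyperbolicWith X α) (reg : IsBusemannRegular X)
    {o : X} {ξ : Boundary X} {x y : X} {R : ℝ} (hx : R ≤ idealProduct o ξ x)
    (hy : R ≤ idealProduct o ξ y) : R - α ≤ gromovProduct o x y :=
  (sub_le_sub_right (le_min hx hy) α).trans (min_idealProduct_le_gromovProduct hα reg o ξ x y)

lemma le_idealProduct_of_le (hα : HyperbolicWith X α) (reg : IsBusemannRegular X)
    {o : X} {ξ : Boundary X} {x y : X} {R : ℝ} (hy : R ≤ idealProduct o ξ y)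
    (h : R ≤ gromovProduct o y x) : R - α ≤ idealProduct o ξ x :=
  (sub_le_sub_right (le_min hy h) α).trans (min_gromovProduct_le_idealProduct hα reg o ξ x y)

/-- Along a geodesic ray a Busemann function first increases and then decreases, up to a bounded
error. -/
lemma min_le_busemann_ray (hα : HyperbolicWith X α) (reg : IsBusemannRegular X)
    (a : GeodesicRay X) (p : Boundary X) {t t₀ : ℝ≥0} (h : t ≤ t₀) :
    min (t : ℝ) (busemann p (a 0) (a t₀) + t₀ - t) - 2 * α ≤ busemann p (a 0) (a t) := by
  -- The four point inequality for `p`, `a t₀`, `a t`, where the product of the two points on the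
  -- ray is exactly `t`.
  have h1 := min_gromovProduct_le_idealProduct hα reg (a 0) p (a t) (a t₀)
  have h2 : gromovProduct (a 0) (a t₀) (a t) = t := by
    unfold gromovProduct
    rw [dist_comm _ (a 0), dist_comm _ (a 0), a.dist_zero, a.dist_zero, dist_comm,
      a.dist_eq_of_le h]
    ring
  rw [h2, idealProduct, idealProduct, a.dist_zero, a.dist_zero] at h1
  rcases min_choice (((t₀ : ℝ) + busemann p (a 0) (a t₀)) / 2) (t : ℝ) with h3 | h3 <;>
    rw [h3] at h1
  · have := min_le_right (t : ℝ) (busemann p (a 0) (a t₀) + t₀ - t)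
    linarith
  · have := min_le_left (t : ℝ) (busemann p (a 0) (a t₀) + t₀ - t)
    linarith

end Busemann

/-! ### Rays as limits of segments. -/

section Rays

variable {X : Type*} [MetricSpace X] {α : ℝ}

lemma IsUniquelyGeodesic.exists_segment (h : IsUniquelyGeodesic X) (x y : X) :
    ∃ g : ℝ≥0 → X, g 0 = x ∧ ∀ s : ℝ≥0, (s : ℝ) ≤ dist x y →
      dist (g s) y = dist x y - s ∧
      ∀ t : ℝ≥0, (t : ℝ) ≤ dist x y → dist (g s) (g t) = dist s t := by
  obtain ⟨f, ⟨hf, hx, hy⟩, -⟩ := h x y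
  have key : ∀ s : ℝ≥0, ∀ hs : (s : ℝ) ≤ dist x y,
      f (projIcc 0 (dist x y) dist_nonneg s) = f ⟨s, s.coe_nonneg, hs⟩ := by
    intro s hs
    exact congrArg f (projIcc_of_mem dist_nonneg (x := (s : ℝ)) ⟨s.coe_nonneg, hs⟩)
  refine ⟨fun s => f (projIcc 0 (dist x y) dist_nonneg s), ?_, fun s hs => ⟨?_, fun t ht => ?_⟩⟩
  · exact (key 0 (by simp)).trans hx
  · simp only [key s hs]
    refine (congrArg (dist _) hy.symm).trans ?_
    rw [hf.dist_eq, Subtype.dist_eq, Real.dist_eq, abs_sub_comm, abs_of_nonneg]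
    simpa using hs
  · simp only [key s hs, key t ht]
    rw [hf.dist_eq]; rfl

/-- The segments from `o` to a sequence of points going to infinity accumulate at a ray. -/
lemma IsBusemannRegular.exists_limit_ray (reg : IsBusemannRegular X) (o : X) {y : ℕ → X}
    (hy : Tendsto (fun n => dist o (y n)) atTop atTop) :
    ∃ a : GeodesicRay X, a 0 = o ∧
      ∀ (t : ℝ≥0) (N : ℕ), ∃ n, N ≤ n ∧ (t : ℝ) - 1 ≤ gromovProduct o (y n) (a t) := by
  have := reg.proper
  choose g hg0 hg using fun n => reg.uniquelyGeodesic.exists_segment o (y n)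
  -- Pointwise limits along a nonprincipal ultrafilter, which exist by properness, replace the
  -- extraction of a subsequence.
  have hω : (hyperfilter ℕ : Filter ℕ) ≤ atTop := by
    rw [← Nat.cofinite_eq_atTop]; exact hyperfilter_le_cofinite
  have hlarge : ∀ t : ℝ≥0, ∀ᶠ n in (hyperfilter ℕ : Filter ℕ), (t : ℝ) ≤ dist o (y n) :=
    fun t => hω (hy.eventually_ge_atTop t)
  have hdist : ∀ (t : ℝ≥0) n, (t : ℝ) ≤ dist o (y n) → dist (g n t) o = t := by
    intro t n hn
    have := (hg n t hn).2 0 (by simp)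
    rw [hg0] at this
    rw [this, NNReal.dist_eq]; simp
  have hlim : ∀ t : ℝ≥0, ∃ z, Tendsto (fun n => g n t) (hyperfilter ℕ : Filter ℕ) (𝓝 z) := by
    intro t
    have h := (isCompact_closedBall o (t : ℝ)).ultrafilter_le_nhds
      ((hyperfilter ℕ).map fun n => g n t) (by
        rw [le_principal_iff]
        refine (hlarge t).mono fun n hn => ?_
        simp [hdist t n hn])
    obtain ⟨z, -, hz⟩ := h
    exact ⟨z, hz⟩
  choose a ha using hlim
  refine ⟨⟨a, Isometry.of_dist_eq fun s t => ?_⟩, ?_, fun t N => ?_⟩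
  · refine tendsto_nhds_unique ((ha s).dist (ha t)) (tendsto_const_nhds.congr' ?_)
    filter_upwards [hlarge s, hlarge t] with n hs ht
    exact ((hg n s hs).2 t ht).symm
  · exact tendsto_nhds_unique (ha 0) (tendsto_const_nhds.congr fun n => (hg0 n).symm)
  · have h1 : ∀ᶠ n in (hyperfilter ℕ : Filter ℕ), dist (g n t) (a t) < 1 :=
      (ha t).eventually (Metric.ball_mem_nhds _ one_pos)
    obtain ⟨n, hn, hnt, hnN⟩ :=
      (h1.and ((hlarge t).and (hω (eventually_ge_atTop N)))).exists
    refine ⟨n, hnN, ?_⟩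
    change _ ≤ gromovProduct o (y n) (a t)
    have h2 := (hg n t hnt).1
    have h3 := hdist t n hnt
    have h4 := dist_triangle (g n t) (a t) o
    have h5 := dist_triangle_left (y n) (a t) (g n t)
    unfold gromovProduct
    rw [dist_comm (y n) o]
    linarith

/-- The limit of the segments from `o` to `b n` stays close to `b`: both `a t` and `b t` have Gromov
product about `t` with a far point `b n`. -/
lemma exists_ray_from (hα : HyperbolicWith X α) (reg : IsBusemannRegular X) (o : X)
    (ξ : Boundary X) : ∃ a : GeodesicRay X, a 0 = o ∧ a.endpoint = ξ := by
  obtain ⟨b, hb⟩ := ξ.exists_ray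
  have hy : Tendsto (fun n : ℕ => dist o (b n)) atTop atTop := by
    refine tendsto_atTop_mono (f := fun n : ℕ => (n : ℝ) + -dist o (b 0)) (fun n => ?_)
      (tendsto_atTop_add_const_right _ _ tendsto_natCast_atTop_atTop)
    have h1 := b.dist_zero n
    have h2 := dist_triangle_left (b 0) (b n) o
    simp only [NNReal.coe_natCast] at h1
    linarith
  obtain ⟨a, ha, hay⟩ := reg.exists_limit_ray o hy
  refine ⟨a, ha, ?_⟩
  rw [← hb, GeodesicRay.endpoint_eq_iff]
  refine ⟨3 * dist o (b 0) + 2 + 2 * α, fun t => ?_⟩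
  obtain ⟨N, hN⟩ := exists_nat_ge t
  obtain ⟨n, hn, h⟩ := hay t N
  have h1 := b.le_gromovProduct o (s := n) (t := t) (hN.trans (by exact_mod_cast hn))
  have h0 : 0 ≤ dist o (b 0) := dist_nonneg
  have h2 := hα.le_of_le (o := o) (x := a t) (y := b t) (z := b n)
    (R := t - dist o (b 0) - 1) (by rw [gromovProduct_comm]; linarith) (by linarith)
  have h3 : dist (a t) o = t := by rw [dist_comm, ← ha, a.dist_zero]
  have h4 := dist_triangle_left (b t) o (b 0)
  rw [b.dist_zero, dist_comm (b 0) o] at h4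
  unfold gromovProduct at h2
  linarith

lemma dist_ray_le_of_endpoint_eq (hα : HyperbolicWith X α) {a b : GeodesicRay X}
    (h₀ : a 0 = b 0) (h : a.endpoint = b.endpoint) (t : ℝ≥0) : dist (a t) (b t) ≤ 4 * α := by
  obtain ⟨s, hs, hs'⟩ := ((hα.eventually_le_gromovProduct (a 0) h.symm t).and
    (eventually_ge_atTop t)).exists
  have h1 := b.le_gromovProduct (b 0) hs'
  rw [h₀] at hs
  rw [dist_self] at h1 hs
  have h2 := hα.le_of_le (o := b 0) (x := a t) (y := b t) (z := b s)
    (R := t - α) (by rw [gromovProduct_comm]; linarith) (by linarith [hα.nonneg (b 0)])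
  have h3 : dist (a t) (b 0) = t := by rw [dist_comm, ← h₀, a.dist_zero]
  have h4 : dist (b t) (b 0) = t := by rw [dist_comm, b.dist_zero]
  rw [gromovProduct, h3, h4] at h2
  linarith

end Rays

/-! ### Separation of boundary points. -/

section Separation

variable {X : Type*} [MetricSpace X] {α : ℝ}

/-- Distinct boundary points have a finite Gromov product. -/
lemma exists_min_idealProduct_le (hα : HyperbolicWith X α) (reg : IsBusemannRegular X) (o : X)
    {ξ η : Boundary X} (h : ξ ≠ η) :
    ∃ M, 0 ≤ M ∧ ∀ x, min (idealProduct o ξ x) (idealProduct o η x) ≤ M := by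
  by_contra! hM
  obtain ⟨a, rfl, rfl⟩ := exists_ray_from hα reg o ξ
  obtain ⟨b, hb, rfl⟩ := exists_ray_from hα reg (a 0) η
  refine h (GeodesicRay.endpoint_eq_iff.2 ⟨4 * α, fun t => ?_⟩)
  obtain ⟨x, hx⟩ := hM t t.coe_nonneg
  have h1 := hx.le.trans (min_le_left _ _)
  have h2 := hx.le.trans (min_le_right _ _)
  have h3 := idealProduct_ray hα reg (a := a) rfl (zero_le (a := t))
  have h4 := idealProduct_ray hα reg (a := b) rfl (zero_le (a := t))
  rw [hb] at h4
  simp only [NNReal.coe_zero, sub_zero] at h3 h4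
  have h5 := hα.le_of_le
    (le_gromovProduct_of_le_idealProduct hα reg h3.ge h1)
    (le_gromovProduct_of_le_idealProduct hα reg h2 h4.ge)
  have h6 : dist (a t) (a 0) = t := by rw [dist_comm, a.dist_zero]
  have h7 : dist (b t) (a 0) = t := by rw [dist_comm, ← hb, b.dist_zero]
  rw [gromovProduct, h6, h7] at h5
  linarith

/-- The Gromov product with `p` is bounded on every compact subset of `∂X ∖ {p}`. -/
lemma IsCompact.exists_min_idealProduct_le (hα : HyperbolicWith X α) (reg : IsBusemannRegular X)
    (o : X) {p : Boundary X} {K : Set (Boundary X)} (hK : IsCompact K) (hp : p ∉ K) :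
    ∃ M, ∀ κ ∈ K, ∀ x, min (idealProduct o κ x) (idealProduct o p x) ≤ M := by
  obtain ⟨b, hb, hbp⟩ := exists_ray_from hα reg o p
  have hpb : ∀ t : ℕ, idealProduct o p (b t) = t := by
    intro t
    have := idealProduct_ray hα reg hbp (zero_le (a := (t : ℝ≥0)))
    rw [hb] at this
    simpa using this
  -- Failing to see `b t` to within `2α` is an open condition on `κ` by Busemann regularity, and it
  -- bounds the product of `κ` and `p` by `t`.
  have hopen : ∀ t : ℕ, IsOpen {κ : Boundary X | idealProduct o κ (b t) < t - 2 * α} := fun t =>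
    isOpen_lt (((continuous_busemann hα reg o (b t)).const_add _).div_const 2)
      continuous_const
  have hcover : K ⊆ ⋃ t : ℕ, {κ : Boundary X | idealProduct o κ (b t) < t - 2 * α} := by
    intro κ hκ
    obtain ⟨M, -, hM⟩ := _root_.exists_min_idealProduct_le hα reg o
      (show κ ≠ p from fun h => hp (h ▸ hκ))
    obtain ⟨t, ht⟩ := exists_nat_gt (M + 2 * α)
    have h0 := hα.nonneg o
    refine mem_iUnion.2 ⟨t, ?_⟩
    have h1 := hM (b t)
    rw [hpb] at h1
    rcases min_le_iff.1 h1 with h | h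
    · exact lt_of_le_of_lt h (by linarith)
    · linarith
  obtain ⟨S, hS⟩ := hK.elim_finite_subcover _ hopen hcover
  refine ⟨(S.sup id : ℕ), fun κ hκ x => ?_⟩
  obtain ⟨t, htS, ht⟩ : ∃ t ∈ S, idealProduct o κ (b t) < t - 2 * α := by
    simpa using hS hκ
  refine le_trans ?_ (Nat.cast_le.2 (Finset.le_sup (f := id) htS))
  by_contra! h
  have h1 := h.le.trans (min_le_left _ _)
  have h2 := h.le.trans (min_le_right _ _)
  simp only [id] at h1 h2
  have h3 := le_idealProduct_of_le hα reg (ξ := κ) (x := b t) (R := t - α)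
    (by linarith [hα.nonneg o]) (le_gromovProduct_of_le_idealProduct hα reg h2 (hpb t).ge)
  linarith

/-- If `y` lies on a ray from `o` to `ξ`, and `l`, `m` are distinct boundary points, then from
every point `w` one of `l`, `m`, `ξ` is seen behind `y`. -/
lemma exists_forall_ray_idealProduct (hα : HyperbolicWith X α) (reg : IsBusemannRegular X)
    (o : X) {l m : Boundary X} (h : l ≠ m) :
    ∃ M, 0 ≤ M ∧ ∀ a : GeodesicRay X, a 0 = o → ∀ t w, ∃ ζ, (ζ = l ∨ ζ = m ∨ ζ = a.endpoint) ∧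
      dist w (a t) - M ≤ idealProduct w ζ (a t) := by
  obtain ⟨M, hM0, hM⟩ := exists_min_idealProduct_le hα reg o h
  have hα0 := hα.nonneg o
  refine ⟨M + 4 * α + 1, by linarith, ?_⟩
  rintro a rfl t w
  by_contra! hcon
  -- Seen from `a t`, all three boundary points would lie in the direction of `w`. One of them is
  -- the endpoint of `a`, so `l` and `m` would both lie ahead along `a`, and then be too close to
  -- each other as seen from `o`.
  have key : ∀ ζ, (ζ = l ∨ ζ = m ∨ ζ = a.endpoint) →
      M + 4 * α + 1 ≤ idealProduct (a t) ζ w := fun ζ hζ => by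
    have h1 := hcon ζ hζ
    have h2 := idealProduct_add hα reg ζ w (a t)
    linarith
  set N : ℝ≥0 := ⟨M + 4 * α + 1, by linarith⟩ with hN
  have hN' : (N : ℝ) = M + 4 * α + 1 := rfl
  have h1 : idealProduct (a t) a.endpoint (a (t + N)) = N := by
    rw [idealProduct_ray hα reg rfl le_self_add]; push_cast; ring
  have h2 := le_gromovProduct_of_le_idealProduct hα reg (key _ (Or.inr (Or.inr rfl)))
    (h1.trans hN').ge
  have h3 : ∀ ζ, (ζ = l ∨ ζ = m) → M < idealProduct (a 0) ζ (a (t + N)) := by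
    intro ζ hζ
    have h4 := le_idealProduct_of_le hα reg (x := a (t + N)) (R := M + 4 * α + 1 - α)
      (by linarith [key ζ (by tauto)]) h2
    have h5 := min_le_busemann_ray hα reg a ζ (le_self_add (a := t) (b := N))
    have h6 := busemann_add hα reg ζ (a 0) (a t) (a (t + N))
    rw [idealProduct, a.dist_eq_of_le le_self_add] at h4
    rw [idealProduct, a.dist_zero]
    push_cast at h4 h5 ⊢
    -- The second alternative says that the Busemann function of `ζ` already decreases from `a t` to
    -- `a (t + N)`, against `h4`.
    rcases min_le_iff.1 (show min (t : ℝ) _ ≤ _ from sub_le_iff_le_add.1 h5) with h7 | h7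
    · linarith [t.coe_nonneg]
    · linarith
  have h4 := hM (a (t + N))
  rcases min_le_iff.1 h4 with h5 | h5
  · exact absurd h5 (h3 _ (Or.inl rfl)).not_ge
  · exact absurd h5 (h3 _ (Or.inr rfl)).not_ge

end Separation

/-! ### Equivariance under the isometric action. -/

section Equivariance

variable {Γ X : Type*} [MetricSpace X] [Group Γ] [MulAction Γ X] [IsIsometricSMul Γ X] {α : ℝ}

variable (X) in
/-- The translate of a geodesic ray. -/
def GeodesicRay.translate (g : Γ) (a : GeodesicRay X) : GeodesicRay X :=
  ⟨fun t => g • a t, (isometry_smul X g).comp a.isometry_toFun⟩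

lemma GeodesicRay.endpoint_translate (g : Γ) (a : GeodesicRay X) :
    (a.translate X g).endpoint = g • a.endpoint := rfl

lemma gromovProduct_smul (g : Γ) (o x y : X) :
    gromovProduct (g • o) (g • x) (g • y) = gromovProduct o x y := by
  simp [gromovProduct]

lemma busemann_smul (hα : HyperbolicWith X α) (reg : IsBusemannRegular X) (g : Γ)
    (ξ : Boundary X) (x y : X) : busemann (g • ξ) (g • x) (g • y) = busemann ξ x y := by
  obtain ⟨a, rfl⟩ := ξ.exists_ray
  refine tendsto_nhds_unique
    (tendsto_busemann hα reg (a.endpoint_translate g) (g • x) (g • y))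
    ((tendsto_busemann hα reg (rfl : a.endpoint = _) x y).congr fun t => ?_)
  simp [GeodesicRay.translate]

lemma idealProduct_smul (hα : HyperbolicWith X α) (reg : IsBusemannRegular X) (g : Γ)
    (ξ : Boundary X) (o x : X) :
    idealProduct (g • o) (g • ξ) (g • x) = idealProduct o ξ x := by
  simp [idealProduct, busemann_smul hα reg]

/-- The action of an isometry on `X ∪ ∂X`. -/
def Bordification.translate (g : Γ) : Bordification X → Bordification X
  | .interior x => .interior (g • x)
  | .ideal ξ => .ideal (g • ξ)

lemma Bordification.IsRepresentedBy.inv_smul {g : Γ} {b : Bordification X} {f : ℝ≥0 → X}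
    (h : (b.translate g).IsRepresentedBy f) : b.IsRepresentedBy fun t => g⁻¹ • f t := by
  cases b with
  | interior x => intro t; simp [show f t = g • x from h t]
  | ideal ξ =>
    obtain ⟨a, ha, hf⟩ := h
    refine ⟨a.translate X g⁻¹, ?_, fun t => by simp [hf, GeodesicRay.translate]⟩
    rw [GeodesicRay.endpoint_translate, ha, inv_smul_smul]

lemma Bordification.continuous_translate (g : Γ) :
    Continuous (Bordification.translate g : Bordification X → Bordification X) := by
  refine ⟨fun U hU => ⟨hU.1.preimage (isometry_smul X g).continuous, fun ξ hξ o => ?_⟩⟩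
  obtain ⟨R, hR⟩ := hU.2 (g • ξ) hξ (g • o)
  refine ⟨R, fun b hb => hR fun f k hf hk => ?_⟩
  refine (hb _ _ (Bordification.IsRepresentedBy.inv_smul (b := .ideal ξ) hf)
    hk.inv_smul).mono fun q hq => ?_
  rwa [← gromovProduct_smul g, smul_inv_smul, smul_inv_smul] at hq

lemma smul_mem_limitSet (g : Γ) {ξ : Boundary X} (h : ξ ∈ limitSet Γ X) :
    g • ξ ∈ limitSet Γ X := by
  intro x
  have := image_closure_subset_closure_image (Bordification.continuous_translate g)
    (mem_image_of_mem _ (h x))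
  refine closure_mono ?_ this
  rintro _ ⟨_, ⟨_, ⟨k, rfl⟩, rfl⟩, rfl⟩
  exact ⟨g • k • x, ⟨g * k, mul_smul g k x⟩, rfl⟩

lemma smul_mem_parabolicPoints (g : Γ) {p : Boundary X} (h : p ∈ parabolicPoints Γ X) :
    g • p ∈ parabolicPoints Γ X := by
  obtain ⟨h1, h2, h3⟩ := h
  refine ⟨smul_mem_limitSet g h1, ?_, ?_⟩
  · have := h2.image (f := fun k => g * k * g⁻¹) (fun a _ b _ hab => by simpa using hab)
    refine this.mono ?_
    rintro _ ⟨k, hk, rfl⟩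
    simp only [SetLike.mem_coe, MulAction.mem_stabilizer_iff] at hk ⊢
    rw [mul_smul, mul_smul, inv_smul_smul, hk]
  · intro k hk hlox
    refine h3 (g⁻¹ * k * g) ?_ ?_
    · rw [MulAction.mem_stabilizer_iff] at hk ⊢
      rw [mul_smul, mul_smul, hk, inv_smul_smul]
    · obtain ⟨x, c, hc, hx⟩ := hlox
      refine ⟨g⁻¹ • x, c, hc, fun n => (hx n).trans_eq ?_⟩
      have : (g⁻¹ * k * g) ^ n = g⁻¹ * k ^ n * g := by
        simpa using conj_pow (a := g⁻¹) (b := k) (i := n)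
      rw [this, mul_smul, smul_inv_smul, mul_smul, dist_smul]

/-- The stabilizer of a parabolic point preserves its horospheres. -/
lemma busemann_smul_eq_zero (hα : HyperbolicWith X α) (reg : IsBusemannRegular X)
    {p : Boundary X} (hp : p ∈ parabolicPoints Γ X) {g : Γ}
    (hg : g ∈ MulAction.stabilizer Γ p) (x : X) : busemann p x (g • x) = 0 := by
  by_contra h
  -- A nonzero shift would add up linearly under iteration, making `g` loxodromic.
  have hpow : ∀ n : ℕ, busemann p x (g ^ n • x) = n * busemann p x (g • x) := by
    intro n
    induction n with
    | zero => simp [busemann_self hα reg]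
    | succ n ih =>
      have hgn : g ^ n • p = p := MulAction.mem_stabilizer_iff.1 (pow_mem hg n)
      have h1 := busemann_smul hα reg (g ^ n) p x (g • x)
      rw [hgn] at h1
      rw [← busemann_add hα reg p x (g ^ n • x), ih, pow_succ, mul_smul, h1]
      push_cast; ring
  refine hp.2.2 g hg ⟨x, |busemann p x (g • x)|, abs_pos.2 h, fun n => ?_⟩
  have h1 := hpow n
  have h2 : |busemann p x (g ^ n • x)| ≤ dist x (g ^ n • x) :=
    abs_le.2 ⟨neg_dist_le_busemann hα reg _ _ _, busemann_le_dist hα reg _ _ _⟩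
  rw [h1, abs_mul, Nat.abs_cast] at h2
  linarith

end Equivariance

/-! ### Depth in the horoballs of an invariant packing. -/

section Depth

variable {Γ X : Type*} [MetricSpace X] [Group Γ] [MulAction Γ X] [IsIsometricSMul Γ X] {α : ℝ}

lemma IsUniquelyGeodesic.preconnectedSpace (h : IsUniquelyGeodesic X) : PreconnectedSpace X := by
  refine ⟨isPreconnected_of_forall_pair fun x _ y _ => ?_⟩
  obtain ⟨f, ⟨hf, hx, hy⟩, -⟩ := h x y
  have : PreconnectedSpace (Icc (0 : ℝ) (dist x y)) :=
    Subtype.preconnectedSpace isPreconnected_Icc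
  exact ⟨range f, subset_univ _, ⟨_, hx⟩, ⟨_, hy⟩, isPreconnected_range hf.continuous⟩

lemma continuous_busemann_right (hα : HyperbolicWith X α) (reg : IsBusemannRegular X)
    (p : Boundary X) (o : X) : Continuous (busemann p o) := by
  refine (LipschitzWith.of_le_add fun x y => ?_).continuous
  have := busemann_add hα reg p o y x
  have h := busemann_le_dist hα reg p y x
  rw [dist_comm] at h
  linarith

/-- The signed depth of `x` in the horoball of the packing that is centered at `p`. -/
noncomputable def depth (o : X) (r : Boundary X → ℝ) (p : Boundary X) (x : X) : ℝ :=
  busemann p o x + Real.log (r p)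

lemma mem_openHoroball_iff {o x : X} {r : Boundary X → ℝ} {p : Boundary X} :
    x ∈ openHoroball o p (r p) ↔ 0 < depth o r p x := by
  simp only [openHoroball, mem_ofPred_eq, depth]
  constructor <;> intro h <;> linarith

lemma depth_sub (hα : HyperbolicWith X α) (reg : IsBusemannRegular X) (o : X)
    (r : Boundary X → ℝ) (p : Boundary X) (x y : X) :
    depth o r p y - depth o r p x = busemann p x y := by
  have := busemann_add hα reg p o x y
  unfold depth
  linarith

/-- Towards `p` the depth rises at unit speed, so every larger value is attained; nothing is claimed
about smaller values, whence the one-sided hypothesis. -/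
lemma exists_depth_eq (hα : HyperbolicWith X α) (reg : IsBusemannRegular X) (o : X)
    (r : Boundary X → ℝ) (p : Boundary X) {x : X} {c : ℝ} (h : depth o r p x ≤ c) :
    ∃ y, depth o r p y = c := by
  have := reg.uniquelyGeodesic.preconnectedSpace
  obtain ⟨a, ha, hap⟩ := exists_ray_from hα reg x p
  have hc : Continuous (depth o r p) := (continuous_busemann_right hα reg p o).add_const _
  obtain ⟨t, ht⟩ : ∃ t : ℝ≥0, (t : ℝ) = c - depth o r p x := ⟨⟨_, by linarith⟩, rfl⟩
  refine mem_range_of_exists_le_of_exists_ge hc ⟨x, h⟩ ⟨a t, ?_⟩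
  have h1 := busemann_ray hα reg hap (zero_le (a := t))
  rw [ha, ← depth_sub hα reg o r] at h1
  rw [NNReal.coe_zero] at h1
  linarith

/-- The depth functions of an invariant packing are invariant. -/
lemma IsHoroballPacking.depth_smul {o : X} {r : Boundary X → ℝ}
    (pack : IsHoroballPacking Γ o r) (hα : HyperbolicWith X α) (reg : IsBusemannRegular X)
    {p : Boundary X} (hp : p ∈ parabolicPoints Γ X) (g : Γ) (x : X) :
    depth o r (g • p) (g • x) = depth o r p x := by
  by_cases hgp : g • p = p
  · have h1 := busemann_smul_eq_zero hα reg hp (MulAction.mem_stabilizer_iff.2 hgp) x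
    rw [← depth_sub hα reg o r] at h1
    rw [hgp]; linarith
  -- The two depth functions differ by a constant and are positive at the same points. A nonzero
  -- constant is excluded once nonpositive depth occurs somewhere, and it does in the disjoint
  -- horoball at `g • p`.
  have hconst : ∀ y, depth o r (g • p) (g • y) - depth o r (g • p) (g • x)
      = depth o r p y - depth o r p x := fun y => by
    rw [depth_sub hα reg, depth_sub hα reg, busemann_smul hα reg]
  have hiff : ∀ y, 0 < depth o r p y ↔ 0 < depth o r (g • p) (g • y) := fun y => by
    rw [← mem_openHoroball_iff, ← mem_openHoroball_iff, ← pack.invariant g p hp]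
    simp
  obtain ⟨z, hz⟩ : ∃ z, depth o r p z ≤ 0 := by
    obtain ⟨z, hz⟩ : ∃ z, 0 < depth o r (g • p) z := by
      rcases le_or_gt (depth o r (g • p) x) 1 with h | h
      · obtain ⟨z, hz⟩ := exists_depth_eq hα reg o r (g • p) h
        exact ⟨z, by linarith⟩
      · exact ⟨x, by linarith⟩
    refine ⟨z, le_of_not_gt fun h => ?_⟩
    exact disjoint_left.1 (pack.disjoint (smul_mem_parabolicPoints g hp) hp hgp)
      (mem_openHoroball_iff.2 hz) (mem_openHoroball_iff.2 h)
  by_contra hne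
  rcases lt_or_gt_of_ne hne with h | h
  · obtain ⟨y, hy⟩ := exists_depth_eq hα reg o r p
      (show depth o r p z ≤ depth o r p x - depth o r (g • p) (g • x) by linarith)
    have := (hiff y).1 (by linarith)
    linarith [hconst y]
  · obtain ⟨y, hy⟩ := exists_depth_eq hα reg o r p hz
    have := (hiff y).2 (by linarith [hconst y])
    linarith

end Depth

/-! ### Nearest orbit points and limit points. -/

section Orbit

variable {Γ X : Type*} [MetricSpace X] [Group Γ] [MulAction Γ X] {α : ℝ}

/-- Every point has a nearest point in an orbit. -/
lemma exists_forall_dist_smul_le [ProperSpace X] [ProperlyDiscontinuousSMul Γ X] (o x : X) :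
    ∃ g : Γ, ∀ k : Γ, dist (g • o) x ≤ dist (k • o) x := by
  have hfin := ProperlyDiscontinuousSMul.finite_disjoint_inter_image (Γ := Γ)
    (isCompact_singleton (x := o)) (isCompact_closedBall x (dist o x))
  obtain ⟨g, hg, hmin⟩ := exists_min_image _ (fun g : Γ => dist (g • o) x) hfin
    ⟨1, o, by simp⟩
  refine ⟨g, fun k => ?_⟩
  by_cases hk : dist (k • o) x ≤ dist o x
  · exact hmin k ⟨k • o, by simpa using hk⟩
  · refine (hmin 1 ⟨o, by simp⟩).trans ?_
    simpa using (not_le.1 hk).le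

/-- A boundary point that is approximated by points of the limit set is a limit point. -/
lemma mem_limitSet_of_forall_exists (hα : HyperbolicWith X α) (reg : IsBusemannRegular X)
    (o : X) {η : Boundary X}
    (h : ∀ R : ℝ, ∃ ζ ∈ limitSet Γ X, ∃ x, R ≤ idealProduct o η x ∧ R ≤ idealProduct o ζ x) :
    η ∈ limitSet Γ X := by
  intro z
  refine mem_closure_iff.2 fun U hU hη => ?_
  obtain ⟨R, hR⟩ := hU.2 η hη o
  obtain ⟨ζ, hζ, x, h1, h2⟩ := h (R + α + 2)
  refine mem_closure_iff.1 (hζ z) U hU (hR ?_)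
  rintro f g ⟨a, ha, hf⟩ ⟨b, hb, hg⟩
  rw [← prod_atTop_atTop_eq]
  have h3 := (tendsto_idealProduct hα reg ha o x).eventually
    (lt_mem_nhds (show R + α + 1 < idealProduct o η x by linarith))
  have h4 := (tendsto_idealProduct hα reg hb o x).eventually
    (lt_mem_nhds (show R + α + 1 < idealProduct o ζ x by linarith))
  refine (h3.prod_mk h4).mono fun q hq => ?_
  have h5 := hα.le_of_le hq.1.le (hq.2.le.trans_eq (gromovProduct_comm _ _ _))
  rw [hf, hg]
  linarith

/-- Sequences in `X` that converge to a boundary point leave every ball. -/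
lemma eventually_lt_dist_of_tendsto {u : ℕ → X} {ξ : Boundary X}
    (h : Tendsto (fun n => Bordification.interior (u n)) atTop (𝓝 (Bordification.ideal ξ)))
    (o : X) (R : ℝ) : ∀ᶠ n in atTop, R < dist o (u n) := by
  -- All boundary points belong to this set vacuously; it is open near them because a Gromov product
  -- is at most the distance to the base point.
  have hopen : IsOpen {b : Bordification X | ∀ x, b = Bordification.interior x → R < dist o x} := by
    refine ⟨?_, fun ζ _ w => ⟨R + dist o w, fun b hb x hx => ?_⟩⟩
    · have : IsOpen {x | R < dist o x} := isOpen_lt continuous_const (by fun_prop)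
      convert this using 1
      ext x; simp
    · obtain ⟨a, ha⟩ := ζ.exists_ray
      subst hx
      obtain ⟨q, hq⟩ := (hb a (fun _ => x) ⟨a, ha, fun _ => rfl⟩ fun _ => rfl).exists
      have h1 := gromovProduct_le_right w (a q.1) x
      have h2 := dist_triangle_right x w o
      rw [dist_comm x o, dist_comm w o] at h2
      linarith
  filter_upwards [h.eventually (hopen.mem_nhds fun x hx => by cases hx)] with n hn
  exact hn _ rfl

end Orbit

/-! ### Rays to limit points stay near the horoballs. -/

section GeometricallyFinite

variable {Γ X : Type*} [MetricSpace X] [Group Γ] [MulAction Γ X] [IsIsometricSMul Γ X] {α : ℝ}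

/-- The orbit of any point `o` comes uniformly close to every ray that ends at a conical limit
point, arbitrarily far out. -/
lemma IsConicalLimitPoint.exists_dist_le {ξ : Boundary X} (h : IsConicalLimitPoint Γ ξ) (o : X)
    {a : GeodesicRay X} (ha : a.endpoint = ξ) :
    ∃ D, ∀ T : ℝ, ∃ (g : Γ) (t : ℝ≥0), T ≤ t ∧ dist (g • o) (a t) ≤ D := by
  obtain ⟨o', b, γ, D, hb, hbξ, hγ, hD⟩ := h
  obtain ⟨C, hC⟩ := GeodesicRay.endpoint_eq_iff.1 (hbξ.trans ha.symm)
  refine ⟨dist o o' + D + C, fun T => ?_⟩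
  obtain ⟨n, hn⟩ := (eventually_lt_dist_of_tendsto hγ o' (T + D)).exists
  obtain ⟨t, ht⟩ := hD n
  refine ⟨γ n, t, ?_, ?_⟩
  · have h1 := b.dist_zero t
    rw [hb] at h1
    have h2 := dist_triangle_right o' (γ n • o') (b t)
    linarith
  · have h1 := dist_triangle4 (γ n • o) (γ n • o') (b t) (a t)
    rw [dist_smul] at h1
    linarith [hC t]

/-- Let `p` be a bounded parabolic point, and let `y` be a point close to `p`, far outside of the
horoballs at `p`, that lies in front of a limit point as seen from `o`. Then `o` is not the point
of its orbit nearest to `y`. -/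
lemma IsBoundedParabolic.exists_dist_lt (hα : HyperbolicWith X α) (reg : IsBusemannRegular X)
    (o : X) {p : Boundary X} (hp : IsBoundedParabolic Γ p) (M : ℝ) :
    ∃ T N : ℝ, ∀ y, T ≤ idealProduct o p y → busemann p o y ≤ -N →
      (∃ ζ ∈ limitSet Γ X, dist o y - M ≤ idealProduct o ζ y) →
      ∃ g : Γ, dist (g • o) y < dist o y := by
  obtain ⟨hpar, K, hK, hKΛ, hcoc⟩ := hp
  obtain ⟨M', hM'⟩ := hK.exists_min_idealProduct_le hα reg o (p := p) fun h => (hKΛ h).2 rfl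
  have hα0 := hα.nonneg o
  refine ⟨max (M' + 1) (M + 2 * α + 1), max 0 (M + 1), ?_⟩
  rintro y hT hN ⟨ζ, hζ, hζy⟩
  by_contra! hcon
  have hT1 := (le_max_left _ _).trans hT
  have hT2 := (le_max_right _ _).trans hT
  have hN1 := hN.trans (neg_le_neg (le_max_left _ _))
  have hN2 := hN.trans (neg_le_neg (le_max_right _ _))
  by_cases hζp : ζ = p
  · have := neg_dist_le_busemann hα reg p o y
    rw [hζp, idealProduct] at hζy
    linarith
  obtain ⟨g, hg, κ, hκ, rfl⟩ := hcoc ζ ⟨hζ, hζp⟩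
  have hw := hcon g
  -- The element `g` preserves the horospheres at `p`, and `o` is assumed nearest to `y`, so moving
  -- the viewpoint to `g • o` can only increase the product.
  have hpw : idealProduct o p y ≤ idealProduct (g • o) p y := by
    have h1 := busemann_smul_eq_zero hα reg hpar hg o
    have h2 := busemann_add hα reg p o (g • o) y
    rw [idealProduct, idealProduct]
    linarith
  -- From `g • o`, the points `p` and `g • κ` are separated as `p` and `κ` are from `o`; since `y`
  -- is near `p`, it is not near `g • κ`.
  have hζw : idealProduct (g • o) (g • κ) y ≤ M' := by
    have h1 := hM' κ hκ (g⁻¹ • y)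
    rw [← idealProduct_smul hα reg g, ← idealProduct_smul hα reg g p o, smul_inv_smul,
      MulAction.mem_stabilizer_iff.1 hg] at h1
    rcases min_le_iff.1 h1 with h | h
    · exact h
    · linarith
  have h1 := idealProduct_add hα reg (g • κ) o y
  have h2 := idealProduct_add hα reg (g • κ) (g • o) y
  have hsymm : ∀ x, idealProduct y p x = idealProduct x p y - busemann p x y := by
    intro x
    rw [idealProduct, idealProduct, busemann_comm hα reg, dist_comm]; ring
  have h3 := hsymm o
  have h4 := hsymm (g • o)
  have h5 := busemann_smul_eq_zero hα reg hpar hg o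
  have h6 := busemann_add hα reg p o (g • o) y
  -- Seen from `y`, both `o` and `g • o` lie towards `p`, and `g • o` lies towards `g • κ`. Hence
  -- `o` lies towards `g • κ`, although `g • κ` is supposed to be behind `y`.
  have h7 := le_gromovProduct_of_le_idealProduct hα reg (o := y) (ξ := p) (x := g • o) (y := o)
    (R := idealProduct o p y) (by linarith) (by linarith)
  have h8 : dist o y = 2 * idealProduct o p y - busemann p o y := by
    rw [idealProduct]; ring
  have h9 := le_idealProduct_of_le hα reg (o := y) (ξ := g • κ) (x := o) (y := g • o)
    (R := idealProduct o p y - α) (by linarith) h7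
  linarith

/-- The rays from `o` to the limit points stay within bounded distance of the horoballs of the
packing. -/
theorem exists_forall_ray_depth [ProperlyDiscontinuousSMul Γ X] (hα : HyperbolicWith X α)
    (reg : IsBusemannRegular X) (fin : IsGeometricallyFinite Γ X)
    (par : (parabolicPoints Γ X).Nonempty) {o : X} {r : Boundary X → ℝ}
    (pack : IsHoroballPacking Γ o r) :
    ∃ D, ∀ a : GeodesicRay X, a 0 = o → a.endpoint ∈ limitSet Γ X → ∀ t,
      ∃ p ∈ parabolicPoints Γ X, -D ≤ depth o r p (a t) := by
  have := reg.proper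
  obtain ⟨p₀, hp₀⟩ := par
  -- With a single limit point every ray in question runs straight into the horoball at `p₀`.
  -- Otherwise a second limit point is available for the change of viewpoint.
  by_cases hΛ : ∀ ξ ∈ limitSet Γ X, ξ = p₀
  · refine ⟨-Real.log (r p₀), fun a ha hξ t => ⟨p₀, hp₀, ?_⟩⟩
    have h1 := busemann_ray hα reg (hΛ _ hξ) (zero_le (a := t))
    rw [ha, NNReal.coe_zero] at h1
    rw [depth, h1]
    linarith [t.coe_nonneg]
  push Not at hΛ
  obtain ⟨l, hl, hlp⟩ := hΛ
  obtain ⟨M, hM0, hM⟩ := exists_forall_ray_idealProduct hα reg o hlp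
  by_contra! hcon
  have hstep : ∀ n : ℕ, ∃ y : X, (∀ g : Γ, dist o y ≤ dist (g • o) y) ∧
      (∀ p ∈ parabolicPoints Γ X, depth o r p y < -n) ∧
      ∃ ζ ∈ limitSet Γ X, dist o y - M ≤ idealProduct o ζ y := by
    intro n
    obtain ⟨a, ha, haξ, t, ht⟩ := hcon n
    obtain ⟨g, hg⟩ := exists_forall_dist_smul_le (Γ := Γ) o (a t)
    refine ⟨g⁻¹ • a t, fun k => ?_, fun p hp => ?_, ?_⟩
    · rw [← dist_smul g, ← dist_smul g (k • o), smul_inv_smul, ← mul_smul]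
      exact hg _
    · rw [← pack.depth_smul hα reg hp g, smul_inv_smul]
      exact ht _ (smul_mem_parabolicPoints g hp)
    -- After the translation the endpoint of the ray need not be behind the point as seen from `o`;
    -- one of `l`, `p₀` and the endpoint is.
    · obtain ⟨ζ, hζ, h⟩ := hM a ha t (g • o)
      refine ⟨g⁻¹ • ζ, smul_mem_limitSet g⁻¹ ?_, ?_⟩
      · rcases hζ with rfl | rfl | rfl
        exacts [hl, hp₀.1, haξ]
      · rw [← idealProduct_smul hα reg g, smul_inv_smul, smul_inv_smul, ← dist_smul g,
          smul_inv_smul]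
        exact h
  choose y hymin hydepth hyζ using hstep
  have hylarge : ∀ n : ℕ, (n : ℝ) + depth o r p₀ o ≤ dist o (y n) := by
    intro n
    have h1 := depth_sub hα reg o r p₀ o (y n)
    have h2 := neg_dist_le_busemann hα reg p₀ o (y n)
    linarith [hydepth n p₀ hp₀]
  obtain ⟨a, ha, hay⟩ := reg.exists_limit_ray o (tendsto_atTop_mono hylarge
    (tendsto_atTop_add_const_right _ _ tendsto_natCast_atTop_atTop))
  have haP : ∀ t : ℝ≥0, idealProduct o a.endpoint (a t) = t := fun t => by
    have := idealProduct_ray hα reg (a := a) rfl (zero_le (a := t))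
    rwa [ha, NNReal.coe_zero, sub_zero] at this
  have hfar : ∀ (T : ℝ≥0) (N : ℕ), ∃ n, N ≤ n ∧
      (T : ℝ) - 1 - α ≤ idealProduct o a.endpoint (y n) := by
    intro T N
    obtain ⟨n, hn, h⟩ := hay T N
    exact ⟨n, hn, le_idealProduct_of_le hα reg (by linarith [haP T])
      (h.trans_eq (gromovProduct_comm _ _ _))⟩
  have hα0 := hα.nonneg o
  have hη : a.endpoint ∈ limitSet Γ X := by
    refine mem_limitSet_of_forall_exists hα reg o fun R => ?_
    obtain ⟨T, hT⟩ := exists_nat_ge (R + 1 + α)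
    obtain ⟨N, hN⟩ := exists_nat_ge (R + M - depth o r p₀ o)
    obtain ⟨n, hn, h⟩ := hfar T N
    obtain ⟨ζ, hζ, h'⟩ := hyζ n
    refine ⟨ζ, hζ, y n, ?_, ?_⟩
    · rw [NNReal.coe_natCast] at h; linarith
    · have : (N : ℝ) ≤ n := by exact_mod_cast hn
      linarith [hylarge n]
  rcases fin _ hη with hcon | hbp
  · obtain ⟨D, hD⟩ := hcon.exists_dist_le o rfl
    -- Passing near `a t` on the way from `o` to `y n` saves at least `t - 2`, which beats the
    -- detour `D` when `t ≥ D + 3`.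
    obtain ⟨g, t, ht, hgt⟩ := hD (D + 3)
    obtain ⟨n, -, h⟩ := hay t 0
    have h1 := hymin n g
    have h2 := dist_triangle (g • o) (a t) (y n)
    have h3 : dist (a t) o = t := by rw [dist_comm, ← ha, a.dist_zero]
    rw [gromovProduct, h3, dist_comm (y n) o, dist_comm (y n)] at h
    linarith
  · obtain ⟨T, N, hTN⟩ := hbp.exists_dist_lt hα reg o M
    obtain ⟨T', hT'⟩ := exists_nat_ge (T + 1 + α)
    obtain ⟨N', hN'⟩ := exists_nat_ge (N + |Real.log (r a.endpoint)|)
    obtain ⟨n, hn, h⟩ := hfar T' N'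
    obtain ⟨g, hg⟩ := hTN (y n) (by rw [NNReal.coe_natCast] at h; linarith) (by
      have h1 := hydepth n _ hbp.1
      have h2 : (N' : ℝ) ≤ n := by exact_mod_cast hn
      have h3 := neg_abs_le (Real.log (r a.endpoint))
      unfold depth at h1
      linarith) (hyζ n)
    exact absurd (hymin n g) (not_le.2 hg)

end GeometricallyFinite

/-! ### Horoballs met by rays, and the main theorem. -/

section Shadows

variable {X : Type*} [MetricSpace X] {α : ℝ}

lemma neg_log_mul_sqrt {c s ρ : ℝ} (hc : 0 < c) (hs : 0 < s) (hρ : 0 < ρ) :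
    -Real.log (c * √(s * ρ)) = -Real.log c - Real.log s / 2 - Real.log ρ / 2 := by
  rw [Real.log_mul hc.ne' (Real.sqrt_pos.2 (mul_pos hs hρ)).ne', Real.log_sqrt (mul_pos hs hρ).le,
    Real.log_mul hs.ne' hρ.ne']
  ring

/-- A ray that meets a horoball at depth `h` stays in the larger horoballs for a long time. -/
lemma min_le_busemann_of_mem_horoball (hα : HyperbolicWith X α) (reg : IsBusemannRegular X)
    (a : GeodesicRay X) (p : Boundary X) {t₀ : ℝ≥0} {h : ℝ}
    (ht₀ : h ≤ busemann p (a 0) (a t₀)) (t : ℝ≥0) :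
    min (t : ℝ) (2 * h - t) - 2 * α ≤ busemann p (a 0) (a t) := by
  have h1 := busemann_le_dist hα reg p (a 0) (a t₀)
  rw [a.dist_zero] at h1
  rcases le_total t t₀ with h2 | h2
  · refine le_trans ?_ (min_le_busemann_ray hα reg a p h2)
    gcongr
    linarith
  · have h3 := busemann_add hα reg p (a 0) (a t₀) (a t)
    have h4 := neg_dist_le_busemann hα reg p (a t₀) (a t)
    rw [a.dist_eq_of_le h2] at h4
    have h5 := min_le_right (t : ℝ) (2 * h - t)
    linarith [hα.nonneg (a 0)]

/-- If a point of a ray is not far from a horoball at `p`, then the ray meets a horoball at `p` of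
which the size is controlled. -/
lemma exists_le_busemann_ray (hα : HyperbolicWith X α) (reg : IsBusemannRegular X)
    (a : GeodesicRay X) (p : Boundary X) (t : ℝ≥0) :
    ∃ u, (t + busemann p (a 0) (a t)) / 2 - 2 * α ≤ busemann p (a 0) (a u) := by
  have h1 := busemann_le_dist hα reg p (a 0) (a t)
  have h2 := neg_dist_le_busemann hα reg p (a 0) (a t)
  rw [a.dist_zero] at h1 h2
  obtain ⟨u, hu⟩ : ∃ u : ℝ≥0, (u : ℝ) = (t + busemann p (a 0) (a t)) / 2 :=
    ⟨⟨_, by linarith⟩, rfl⟩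
  have hut : u ≤ t := by
    rw [← NNReal.coe_le_coe]; linarith
  refine ⟨u, le_trans ?_ (min_le_busemann_ray hα reg a p hut)⟩
  gcongr
  exact le_min hu.ge (by linarith)

end Shadows

theorem theoremT {X Γ : Type*} [MetricSpace X] [Group Γ] [MulAction Γ X] [IsIsometricSMul Γ X]
    [ProperlyDiscontinuousSMul Γ X]
    (hyp : IsGromovHyperbolic X) (reg : IsBusemannRegular X)
    (fin : IsGeometricallyFinite Γ X) (par : (parabolicPoints Γ X).Nonempty)
    (o : X) (r : Boundary X → ℝ) (pack : IsHoroballPacking Γ o r) :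
    ∃ c₁ c₂ c₃ : ℝ, 0 < c₁ ∧ 0 < c₂ ∧ 0 < c₃ ∧ ∀ s : ℝ, 0 < s → s ≤ c₁ →
      (limitSet Γ X ⊆ ⋃ p ∈ largeParabolicPoints Γ r s,
        shadow o (horoball o p (c₂ * √(s * r p)))) ∧
      (largeParabolicPoints Γ r s).PairwiseDisjoint
        fun p => shadow o (horoball o p (c₃ * √(s * r p))) := by
  obtain ⟨α, hα0, hα⟩ := hyp
  replace hα : HyperbolicWith X α := hα
  obtain ⟨D, hD⟩ := exists_forall_ray_depth hα reg fin par pack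
  -- The bound `s ≤ c₁` makes the time `-log s - |D|` nonnegative; `c₂` absorbs the defect `(|D| +
  -- D)/2` and the tent error `2α`.
  refine ⟨Real.exp (-|D|), Real.exp (|D| + 2 * α), Real.exp (-10 * α), Real.exp_pos _,
    Real.exp_pos _, Real.exp_pos _, fun s hs hsc => ?_⟩
  have hlog : Real.log s ≤ -|D| := (Real.log_le_iff_le_exp hs).2 hsc
  refine ⟨fun ξ hξ => ?_, fun p hp q hq hpq => ?_⟩
  · obtain ⟨a, ha, rfl⟩ := exists_ray_from hα reg o ξ
    obtain ⟨t, ht⟩ : ∃ t : ℝ≥0, (t : ℝ) = -Real.log s - |D| := ⟨⟨_, by linarith⟩, rfl⟩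
    obtain ⟨p, hp, hpt⟩ := hD a ha hξ t
    have hrp := pack.pos p hp
    have h1 := busemann_le_dist hα reg p (a 0) (a t)
    rw [a.dist_zero] at h1
    have h2 := le_abs_self D
    rw [depth, ← ha] at hpt
    refine mem_iUnion₂.2 ⟨p, ⟨hp, ?_⟩, a, ha, rfl, ?_⟩
    · rw [← Real.log_le_log_iff hs hrp]
      linarith
    · obtain ⟨u, hu⟩ := exists_le_busemann_ray hα reg a p t
      refine ⟨u, ?_⟩
      rw [horoball, mem_ofPred_eq, neg_log_mul_sqrt (Real.exp_pos _) hs hrp, Real.log_exp, ← ha]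
      linarith
  · refine disjoint_left.2 ?_
    rintro ξ ⟨a, ha, haξ, u, hu⟩ ⟨b, hb, hbξ, v, hv⟩
    have hrp := pack.pos p hp.1
    have hrq := pack.pos q hq.1
    have hsp := Real.log_le_log hs hp.2
    have hsq := Real.log_le_log hs hq.2
    rw [horoball, mem_ofPred_eq, neg_log_mul_sqrt (Real.exp_pos _) hs hrp, Real.log_exp,
      ← ha] at hu
    rw [horoball, mem_ofPred_eq, neg_log_mul_sqrt (Real.exp_pos _) hs hrq, Real.log_exp,
      ← hb] at hv
    -- The `7α` exceeds the tent error `2α` plus the distance `4α` between the rays, which settles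
    -- the rising side. On the falling side the `10α` in `c₃` counts twice, and `20α - 7α` exceeds
    -- the same `6α`. Strictness uses `0 < α`.
    obtain ⟨t, ht⟩ : ∃ t : ℝ≥0, (t : ℝ) = -Real.log s + 7 * α :=
      ⟨⟨_, by linarith [abs_nonneg D]⟩, rfl⟩
    have h1 := min_le_busemann_of_mem_horoball hα reg a p hu t
    have h2 := min_le_busemann_of_mem_horoball hα reg b q hv t
    have h3 := dist_ray_le_of_endpoint_eq hα (ha.trans hb.symm) (haξ.trans hbξ.symm) t
    have h4 := busemann_add hα reg q (b 0) (b t) (a t)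
    have h5 := neg_dist_le_busemann hα reg q (b t) (a t)
    rw [dist_comm] at h5
    refine Set.disjoint_left.1 (pack.disjoint hp.1 hq.1 hpq)
      (show a t ∈ openHoroball o p (r p) from ?_) ?_
    · change -Real.log (r p) < busemann p o (a t)
      rw [← ha]
      rcases min_le_iff.1 (sub_le_iff_le_add.1 h1) with h | h <;> linarith
    · change -Real.log (r q) < busemann q o (a t)
      rw [← hb]
      rcases min_le_iff.1 (sub_le_iff_le_add.1 h2) with h | h <;> linarith
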